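/- Let the polynomials $Q_n(x)$ be defined by $Q_0(x)=1$ and $Q_n(x)=x\sum_{k=1}^{n}k\,Q_{n-k}(x)$ for $n\ge 1$, and write $Q_n(x)=\sum_{k=0}^{n}A_{n,k}\,x^k$. For each $n$ let $X_n$ be a random variable with values in $\{0,1,\dots,n\}$ and $$P(X_n=k)=\frac{A_{n,k}}{\sum_{m=0}^{n}A_{n,m}}=\frac{A_{n,k}}{Q_n(1)},\qquad 0\le k\le n.$$ Let $\Phi(x)=\frac{1}{\sqrt{2\pi}}\int_{-\infty}^{x}e^{-t^2/2}\,dt$. Then $\mathbb{V}(X_n)>0$ for all $n\ge 2$, and the normalized random variables $$X_n^{*}=\frac{X_n-\mathbb{E}(X_n)}{\sqrt{\mathbb{V}(X_n)}}\qquad(n\ge 2)$$ converge in distribution to the standard normal distribution as $n\to\infty$. Moreover, the convergence of the distribution functions is uniform: $$\lim_{n\to\infty}\ \sup_{x\in\mathbb{R}}\bigl|P(X_n^{*}\le x)-\Phi(x)\bigr|=0,$$ that is, $$\lim_{n\to\infty}\ \sup_{x\in\mathbb{R}}\left|\frac{1}{\sum_{m=0}^{n}A_{n,m}}\sum_{\substack{0\le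 k\le n\\ k\le \mathbb{E}(X_n)+\sqrt{\mathbb{V}(X_n)}\,x}}A_{n,k}-\Phi(x)\right|=0.$$ -/

import Mathlib

open MeasureTheory ProbabilityTheory Filter Topology
open scoped Polynomial ENNReal

/-- The polynomials `Q_n` given by `Q_0 = 1` and `Q_n(x) = x * ∑_{k=1}^n k * Q_{n-k}(x)` for `n ≥ 1`.
The sum below runs over `j = k - 1`; the form with `k` is proved in `Q_eq`. -/
noncomputable def Q : ℕ → ℕ[X]
  | 0 => 1
  | n + 1 => Polynomial.X * ∑ j : Fin (n + 1), ((j : ℕ) + 1) • Q (n - j)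
termination_by n => n
decreasing_by omega

theorem Q_zero : Q 0 = 1 := by
  rw [Q]

/-- The defining recurrence, in its usual form. -/
theorem Q_eq (n : ℕ) (hn : 1 ≤ n) :
    Q n = Polynomial.X * ∑ k ∈ Finset.Icc 1 n, k • Q (n - k) := by
  obtain ⟨m, rfl⟩ : ∃ m, n = m + 1 := ⟨n - 1, by omega⟩
  rw [Q, Fin.sum_univ_eq_sum_range (fun j => (j + 1) • Q (m - j)) (m + 1),
    ← Finset.Ico_add_one_right_eq_Icc, Finset.sum_Ico_eq_sum_range]
  congr 1
  refine Finset.sum_congr (by simp) fun j _ => ?_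
  rw [Nat.add_comm 1 j, Nat.add_sub_add_right]

/-- The coefficient `A_{n,k}` of `x^k` in `Q_n(x)`. -/
noncomputable def A (n k : ℕ) : ℕ := (Q n).coeff k

/-- The standard normal distribution function. -/
noncomputable def stdNormalCDF (x : ℝ) : ℝ :=
  1 / Real.sqrt (2 * Real.pi) * ∫ t in Set.Iic x, Real.exp (-t ^ 2 / 2)

/-- The supremum norm of a real function on `ℝ`, as an extended nonnegative real. -/
noncomputable def supNorm (f : ℝ → ℝ) : ℝ≥0∞ := ⨆ x : ℝ, ‖f x‖ₑ

/-- The random variable `X` centred at its expected value and divided by its standard deviation. -/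
noncomputable def standardized {Ω : Type*} [MeasurableSpace Ω] (P : Measure Ω) (X : Ω → ℝ) :
    Ω → ℝ :=
  fun ω => (X ω - ∫ ω', X ω' ∂P) / Real.sqrt (variance X P)

/-! Differencing the recurrence twice gives a Chebyshev-type three-term recurrence (`Q_add_three`),
so `Q n` has the explicit real roots `-(2 - 2 cos (kπ/n))`, `0 ≤ k < n` (`map_Q_eq_prod`). As these
are nonpositive, `Q n` divided by its value at 1 is the generating polynomial of a sum of `n`
independent Bernoulli variables (`coeff_bernoulliSumPoly_bernoulliProb`). The variance is at least
`n / 25` for `n ≥ 2` (`sum_bernoulliProb_mul_one_sub_ge`), so Lyapunov's argument makes the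
characteristic functions converge to the Gaussian one (`tendsto_prod_centredBernoulliCharFun`), and
Lévy's theorem gives convergence in distribution. The limit has no atoms, so Pólya's theorem makes
the convergence uniform. -/

/-! ### Three-term recurrence and Chebyshev factorization -/

theorem Q_add_two (n : ℕ) :
    Q (n + 2) = Q (n + 1) + Polynomial.X * ∑ j ∈ Finset.range (n + 2), Q j := by
  have key : ∀ m, Q (m + 1) =
      Polynomial.X * ∑ j ∈ Finset.range (m + 1), (j + 1) • Q (m - j) := fun m ↦ by
    rw [Q, Fin.sum_univ_eq_sum_range (fun j ↦ (j + 1) • Q (m - j)) (m + 1)]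
  rw [key (n + 1), key n, ← mul_add]
  congr 1
  rw [Finset.sum_range_succ', Finset.sum_range_succ (fun j ↦ Q j) (n + 1),
    ← Finset.sum_range_reflect (fun j ↦ Q j) (n + 1), ← add_assoc, ← Finset.sum_add_distrib]
  simp only [Nat.add_sub_add_right, Nat.sub_zero, zero_add, one_smul, Nat.add_sub_cancel]
  congr 1
  exact Finset.sum_congr rfl fun j _ ↦ succ_nsmul _ _

/-- This is the second difference of the recurrence. One index lower it fails, because `Q 0 = 1`
breaks the pattern. -/
theorem Q_add_three (n : ℕ) :
    Q (n + 3) + Q (n + 1) = (Polynomial.X + 2) * Q (n + 2) := by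
  have h := Q_add_two (n + 1)
  rw [Finset.sum_range_succ] at h
  have h' := Q_add_two n
  calc Q (n + 3) + Q (n + 1)
      = Q (n + 2) + Polynomial.X * Q (n + 2) +
          (Q (n + 1) + Polynomial.X * ∑ j ∈ Finset.range (n + 2), Q j) := by rw [h]; ring
    _ = _ := by rw [← h']; ring

theorem Q_one : Q 1 = Polynomial.X := by
  simp [Q_eq 1 le_rfl, Q_zero]

theorem Q_two : Q 2 = Polynomial.X * (Polynomial.X + 2) := by
  rw [Q_add_two 0]
  simp [Finset.sum_range_succ, Q_zero, Q_one]
  ring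

/-- `Q (n + 1)` is `X` times a rescaled and shifted Chebyshev polynomial of the second kind. -/
theorem map_Q_succ (n : ℕ) : (Q (n + 1)).map (Nat.castRingHom ℝ) =
    Polynomial.X * (Polynomial.Chebyshev.S ℝ n).comp (Polynomial.X + 2) := by
  induction n using Nat.twoStepInduction with
  | zero => simp [Q_one]
  | one => simp [Q_two]
  | more n ih₁ ih₂ =>
    have h := congrArg (Polynomial.map (Nat.castRingHom ℝ)) (Q_add_three n)
    simp only [Polynomial.map_add, Polynomial.map_mul, Polynomial.map_X,
      Polynomial.map_ofNat, ih₁, ih₂] at h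
    push_cast at h ⊢
    rw [Polynomial.Chebyshev.S_add_two]
    simp only [Polynomial.sub_comp, Polynomial.mul_comp, Polynomial.X_comp]
    linear_combination h

/-- The known roots are distinct and as many as the degree, so the polynomial splits. -/
theorem Chebyshev_U_eq_prod (n : ℕ) : Polynomial.Chebyshev.U ℝ n = Polynomial.C (2 ^ n) *
    ∏ k ∈ Finset.range n,
      (Polynomial.X - Polynomial.C (Real.cos ((k + 1) * Real.pi / (n + 1)))) := by
  have hinj := (Finset.range n).nodup_map_iff_injOn.mp
    (Polynomial.Chebyshev.roots_U_real_nodup n)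
  have hroots := Polynomial.Chebyshev.roots_U_real n
  have h := Polynomial.C_leadingCoeff_mul_prod_multiset_X_sub_C
    (p := Polynomial.Chebyshev.U ℝ n) (by
      rw [hroots, Finset.card_val, Finset.card_image_of_injOn hinj, Finset.card_range,
        Polynomial.Chebyshev.natDegree_U_natCast])
  rw [Polynomial.Chebyshev.leadingCoeff_U_natCast, hroots] at h
  conv_lhs => rw [← h]
  congr 1
  exact Finset.prod_image hinj

/-- The polynomials `Q n` are real-rooted, with nonpositive roots. -/
theorem map_Q_eq_prod (n : ℕ) : (Q n).map (Nat.castRingHom ℝ) =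
    ∏ k ∈ Finset.range n,
      (Polynomial.X + Polynomial.C (2 - 2 * Real.cos (k * Real.pi / n))) := by
  cases n with
  | zero => simp [Q_zero]
  | succ n =>
    -- The factor `k = 0` is `X` itself, since `cos 0 = 1`.
    rw [map_Q_succ, Finset.prod_range_succ', mul_comm]
    simp only [Nat.cast_zero, zero_mul, zero_div, Real.cos_zero, mul_one, sub_self,
      Polynomial.C_0, add_zero]
    congr 1
    have : Invertible (2 : ℝ) := invertibleOfNonzero two_ne_zero
    rw [Polynomial.Chebyshev.S_eq_U_comp_half_mul_X, Chebyshev_U_eq_prod, Polynomial.comp_assoc]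
    simp only [Polynomial.mul_comp, Polynomial.C_comp, Polynomial.X_comp, Polynomial.prod_comp,
      Polynomial.sub_comp]
    -- One factor 2 of `2 ^ n` goes to each root, cancelling the half in `S = U(X/2)`.
    rw [← Finset.card_range n, ← Finset.prod_const, Finset.card_range,
      map_prod, ← Finset.prod_mul_distrib]
    refine Finset.prod_congr rfl fun k _ ↦ ?_
    rw [mul_sub, ← mul_assoc, ← Polynomial.C_mul, ← Polynomial.C_mul, mul_invOf_self,
      Polynomial.C_1, Polynomial.C_sub]
    push_cast
    rw [show (Polynomial.C (2 : ℝ)) = 2 from rfl]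
    ring

/-! ### Success probabilities and linear growth of the variance -/

/-- The success probabilities of the independent Bernoulli variables whose sum has generating
polynomial `Q n`, suitably normalized. -/
noncomputable def bernoulliProb (n k : ℕ) : ℝ := 1 / (1 + (2 - 2 * Real.cos (k * Real.pi / n)))

theorem bernoulliProb_pos (n k : ℕ) : 0 < bernoulliProb n k := by
  have := Real.cos_le_one (k * Real.pi / n)
  unfold bernoulliProb
  apply one_div_pos.mpr
  linarith

theorem bernoulliProb_le_one (n k : ℕ) : bernoulliProb n k ≤ 1 := by
  have := Real.cos_le_one (k * Real.pi / n)
  unfold bernoulliProb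
  rw [div_le_one] <;> linarith

/-- With `p = 1 / (1 + a)` the variance is `a / (1 + a) ^ 2`, and `a ≤ 4` gives the 25. -/
theorem bernoulliProb_mul_one_sub_ge (n k : ℕ) :
    (2 - 2 * Real.cos (k * Real.pi / n)) / 25 ≤ bernoulliProb n k * (1 - bernoulliProb n k) := by
  have h₁ := Real.cos_le_one (k * Real.pi / n)
  have h₂ := Real.neg_one_le_cos (k * Real.pi / n)
  unfold bernoulliProb
  set a := 2 - 2 * Real.cos (k * Real.pi / n) with ha
  have ha₀ : 0 ≤ a := by linarith
  have ha₄ : a ≤ 4 := by linarith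
  have : 1 / (1 + a) * (1 - 1 / (1 + a)) = a / (1 + a) ^ 2 := by field_simp; ring
  rw [this]
  gcongr
  nlinarith

/-- Reflecting the angles in `π / 2` changes the sign of the sum. -/
theorem sum_cos_eq_zero (n : ℕ) :
    ∑ k ∈ Finset.range n, Real.cos (((k + 1 : ℕ) : ℝ) * Real.pi / ((n + 1 : ℕ) : ℝ)) = 0 := by
  have h := Finset.sum_range_reflect
    (fun k : ℕ ↦ Real.cos (((k + 1 : ℕ) : ℝ) * Real.pi / ((n + 1 : ℕ) : ℝ))) n
  have h' : ∀ k ∈ Finset.range n,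
      Real.cos (((n - 1 - k + 1 : ℕ) : ℝ) * Real.pi / ((n + 1 : ℕ) : ℝ)) =
        -Real.cos (((k + 1 : ℕ) : ℝ) * Real.pi / ((n + 1 : ℕ) : ℝ)) := fun k hk ↦ by
    have hk := Finset.mem_range.mp hk
    rw [← Real.cos_pi_sub, show n - 1 - k + 1 = n - k by omega, Nat.cast_sub hk.le]
    congr 1
    push_cast
    field_simp
    ring
  rw [Finset.sum_congr rfl h', Finset.sum_neg_distrib] at h
  linarith

theorem sum_bernoulliProb_mul_one_sub_ge {n : ℕ} (hn : 2 ≤ n) :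
    (n : ℝ) / 25 ≤ ∑ k ∈ Finset.range n, bernoulliProb n k * (1 - bernoulliProb n k) := by
  refine le_trans ?_ (Finset.sum_le_sum fun k _ ↦ bernoulliProb_mul_one_sub_ge n k)
  obtain ⟨m, rfl⟩ : ∃ m, n = m + 1 := ⟨n - 1, by omega⟩
  rw [← Finset.sum_div, Finset.sum_sub_distrib, ← Finset.mul_sum,
    Finset.sum_range_succ' (fun k : ℕ ↦ Real.cos (k * Real.pi / ((m + 1 : ℕ) : ℝ))),
    sum_cos_eq_zero]
  -- Only `cos 0 = 1` survives, so the numerators sum to `2n - 2`, which is at least `n` once `n ≥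
  -- 2`.
  have : (1 : ℝ) ≤ m := by exact_mod_cast (by omega : 1 ≤ m)
  gcongr
  simp
  linarith

theorem sum_A_eq_eval (n : ℕ) : ∑ m ∈ Finset.range (n + 1), (A n m : ℝ) =
    ((Q n).map (Nat.castRingHom ℝ)).eval 1 := by
  have hdeg : ((Q n).map (Nat.castRingHom ℝ)).natDegree < n + 1 := by
    rw [map_Q_eq_prod, Nat.lt_succ_iff]
    refine (Polynomial.natDegree_prod_le _ _).trans ((Finset.sum_le_card_nsmul _ _ 1
      fun k _ ↦ (Polynomial.natDegree_X_add_C _).le).trans (by simp))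
  rw [Polynomial.eval_eq_sum_range' hdeg]
  simp [A]

theorem sum_A_pos (n : ℕ) : 0 < ∑ m ∈ Finset.range (n + 1), (A n m : ℝ) := by
  rw [sum_A_eq_eval, map_Q_eq_prod, Polynomial.eval_prod]
  refine Finset.prod_pos fun k _ ↦ ?_
  have := one_div_pos.mp (bernoulliProb_pos n k)
  simpa using this

/-! ### Generating polynomials of Bernoulli sums and their moments -/

/-- The probability generating polynomial of a sum of independent Bernoulli variables. -/
noncomputable def bernoulliSumPoly (p : ℕ → ℝ) (n : ℕ) : ℝ[X] :=
  ∏ k ∈ Finset.range n, (Polynomial.C (p k) * Polynomial.X + Polynomial.C (1 - p k))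

theorem bernoulliSumPoly_succ (p : ℕ → ℝ) (n : ℕ) : bernoulliSumPoly p (n + 1) =
    bernoulliSumPoly p n * (Polynomial.C (p n) * Polynomial.X + Polynomial.C (1 - p n)) :=
  Finset.prod_range_succ _ _

/-- Each factor `X + a` is `(1 + a) (p X + (1 - p))`, and the constants multiply to the value of `Q
n` at 1. -/
theorem coeff_bernoulliSumPoly_bernoulliProb (n k : ℕ) :
    (bernoulliSumPoly (bernoulliProb n) n).coeff k =
      (A n k : ℝ) / ∑ m ∈ Finset.range (n + 1), (A n m : ℝ) := by
  have h : (Q n).map (Nat.castRingHom ℝ) =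
      Polynomial.C (∑ m ∈ Finset.range (n + 1), (A n m : ℝ)) *
        bernoulliSumPoly (bernoulliProb n) n := by
    rw [sum_A_eq_eval, map_Q_eq_prod, Polynomial.eval_prod, map_prod, bernoulliSumPoly,
      ← Finset.prod_mul_distrib]
    refine Finset.prod_congr rfl fun k _ ↦ ?_
    have hp := (one_div_pos.mp (bernoulliProb_pos n k)).ne'
    simp only [Polynomial.eval_add, Polynomial.eval_X, Polynomial.eval_C]
    rw [mul_add, ← mul_assoc, ← Polynomial.C_mul, ← Polynomial.C_mul]
    unfold bernoulliProb
    rw [mul_one_div_cancel hp, mul_sub, mul_one_div_cancel hp]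
    simp
  rw [eq_div_iff (sum_A_pos n).ne', mul_comm, ← Polynomial.coeff_C_mul, ← h]
  simp [A]

theorem natDegree_bernoulliSumPoly_le (p : ℕ → ℝ) (n : ℕ) :
    (bernoulliSumPoly p n).natDegree ≤ n := by
  exact (Polynomial.natDegree_prod_le _ _).trans ((Finset.sum_le_card_nsmul _ _ 1
    fun k _ ↦ Polynomial.natDegree_linear_le).trans (by simp))

theorem eval_one_bernoulliSumPoly (p : ℕ → ℝ) (n : ℕ) : (bernoulliSumPoly p n).eval 1 = 1 := by
  simp [bernoulliSumPoly, Polynomial.eval_prod]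

theorem eval_one_derivative_bernoulliSumPoly (p : ℕ → ℝ) (n : ℕ) :
    (Polynomial.derivative (bernoulliSumPoly p n)).eval 1 = ∑ k ∈ Finset.range n, p k := by
  induction n with
  | zero => simp [bernoulliSumPoly]
  | succ n ih =>
    have h := eval_one_bernoulliSumPoly p n
    rw [bernoulliSumPoly_succ, Finset.sum_range_succ]
    simp [Polynomial.derivative_mul, ih, h]

theorem eval_one_derivative_derivative_bernoulliSumPoly (p : ℕ → ℝ) (n : ℕ) :
    (Polynomial.derivative (Polynomial.derivative (bernoulliSumPoly p n))).eval 1 =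
      (∑ k ∈ Finset.range n, p k) ^ 2 - ∑ k ∈ Finset.range n, p k ^ 2 := by
  induction n with
  | zero => simp [bernoulliSumPoly]
  | succ n ih =>
    have h' := eval_one_derivative_bernoulliSumPoly p n
    rw [bernoulliSumPoly_succ, Finset.sum_range_succ, Finset.sum_range_succ]
    simp [Polynomial.derivative_mul, ih, h']
    ring

theorem sum_coeff_bernoulliSumPoly (p : ℕ → ℝ) (n : ℕ) :
    ∑ k ∈ Finset.range (n + 1), (bernoulliSumPoly p n).coeff k = 1 := by
  have h := Polynomial.eval_eq_sum_range'
    (Nat.lt_succ_iff.mpr (natDegree_bernoulliSumPoly_le p n)) 1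
  rw [eval_one_bernoulliSumPoly] at h
  simpa using h.symm

theorem sum_coeff_mul_natCast {G : ℝ[X]} {n : ℕ} (hG : G.natDegree ≤ n) :
    ∑ k ∈ Finset.range (n + 1), G.coeff k * k = (Polynomial.derivative G).eval 1 := by
  have hdeg : (Polynomial.X * Polynomial.derivative G).natDegree < n + 1 := by
    refine Nat.lt_succ_iff.mpr ((Polynomial.natDegree_le_iff_coeff_eq_zero).mpr fun k hk ↦ ?_)
    cases k with
    | zero => simp
    | succ k =>
      rw [Polynomial.coeff_X_mul, Polynomial.coeff_derivative,
        Polynomial.coeff_eq_zero_of_natDegree_lt (hG.trans_lt hk), zero_mul]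
  have h := Polynomial.eval_eq_sum_range' hdeg 1
  rw [Polynomial.eval_mul, Polynomial.eval_X, one_mul] at h
  rw [h]
  refine Finset.sum_congr rfl fun k _ ↦ ?_
  cases k with
  | zero => simp
  | succ k => simp [Polynomial.coeff_derivative]

/-- The operator `G ↦ X G'` multiplies the `k`-th coefficient by `k`; the first-moment formula is
applied to `X G'`. -/
theorem sum_coeff_mul_natCast_sq {G : ℝ[X]} {n : ℕ} (hG : G.natDegree ≤ n) :
    ∑ k ∈ Finset.range (n + 1), G.coeff k * (k : ℝ) ^ 2 =
      (Polynomial.derivative (Polynomial.derivative G)).eval 1 +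
        (Polynomial.derivative G).eval 1 := by
  have hcoeff : ∀ k, (Polynomial.X * Polynomial.derivative G).coeff k = G.coeff k * k := by
    rintro (_ | k)
    · simp
    · simp [Polynomial.coeff_derivative]
  have hdeg : (Polynomial.X * Polynomial.derivative G).natDegree ≤ n :=
    (Polynomial.natDegree_le_iff_coeff_eq_zero).mpr fun k hk ↦ by
      rw [hcoeff, Polynomial.coeff_eq_zero_of_natDegree_lt (hG.trans_lt hk), zero_mul]
  have h := sum_coeff_mul_natCast hdeg
  simp only [hcoeff, Polynomial.derivative_mul, Polynomial.derivative_X, one_mul,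
    Polynomial.eval_add, Polynomial.eval_mul, Polynomial.eval_X] at h
  rw [add_comm (Polynomial.eval _ _), ← h]
  exact Finset.sum_congr rfl fun k _ ↦ by ring

theorem sum_coeff_bernoulliSumPoly_mul_natCast (p : ℕ → ℝ) (n : ℕ) :
    ∑ k ∈ Finset.range (n + 1), (bernoulliSumPoly p n).coeff k * k =
      ∑ k ∈ Finset.range n, p k := by
  rw [sum_coeff_mul_natCast (natDegree_bernoulliSumPoly_le p n),
    eval_one_derivative_bernoulliSumPoly]

theorem sum_coeff_bernoulliSumPoly_mul_sub_sq (p : ℕ → ℝ) (n : ℕ) :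
    ∑ k ∈ Finset.range (n + 1),
        (bernoulliSumPoly p n).coeff k * ((k : ℝ) - ∑ j ∈ Finset.range n, p j) ^ 2 =
      ∑ k ∈ Finset.range n, p k * (1 - p k) := by
  have h₀ := sum_coeff_bernoulliSumPoly p n
  have h₁ := sum_coeff_bernoulliSumPoly_mul_natCast p n
  have h₂ := sum_coeff_mul_natCast_sq (natDegree_bernoulliSumPoly_le p n)
  rw [eval_one_derivative_bernoulliSumPoly, eval_one_derivative_derivative_bernoulliSumPoly] at h₂
  set m := ∑ j ∈ Finset.range n, p j with hm
  have : ∀ k : ℕ, (bernoulliSumPoly p n).coeff k * ((k : ℝ) - m) ^ 2 =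
      (bernoulliSumPoly p n).coeff k * (k : ℝ) ^ 2 -
        2 * m * ((bernoulliSumPoly p n).coeff k * k) + m ^ 2 * (bernoulliSumPoly p n).coeff k :=
    fun k ↦ by ring
  simp only [this, Finset.sum_add_distrib, Finset.sum_sub_distrib, ← Finset.mul_sum, h₀, h₁, h₂,
    mul_sub, mul_one, ← pow_two]
  rw [← hm]
  ring

/-! ### Characteristic functions and Lyapunov's theorem -/

/-- Telescoping: the factors are exchanged one at a time, the others being bounded by 1. -/
theorem norm_prod_sub_prod_le_sum {ι : Type*} (s : Finset ι) (f g : ι → ℂ)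
    (hf : ∀ i ∈ s, ‖f i‖ ≤ 1) (hg : ∀ i ∈ s, ‖g i‖ ≤ 1) :
    ‖∏ i ∈ s, f i - ∏ i ∈ s, g i‖ ≤ ∑ i ∈ s, ‖f i - g i‖ := by
  classical
  induction s using Finset.induction_on with
  | empty => simp
  | insert a s ha ih =>
    rw [Finset.prod_insert ha, Finset.prod_insert ha, Finset.sum_insert ha]
    have ih := ih (fun i hi ↦ hf i (Finset.mem_insert_of_mem hi))
      fun i hi ↦ hg i (Finset.mem_insert_of_mem hi)
    have h₁ : ‖∏ i ∈ s, f i‖ ≤ 1 := by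
      rw [norm_prod]
      exact Finset.prod_le_one (fun _ _ ↦ norm_nonneg _)
        fun i hi ↦ hf i (Finset.mem_insert_of_mem hi)
    have h₂ := hg a (Finset.mem_insert_self a s)
    calc ‖f a * ∏ i ∈ s, f i - g a * ∏ i ∈ s, g i‖
        = ‖(f a - g a) * ∏ i ∈ s, f i + g a * (∏ i ∈ s, f i - ∏ i ∈ s, g i)‖ := by ring_nf
      _ ≤ ‖f a - g a‖ * ‖∏ i ∈ s, f i‖ + ‖g a‖ * ‖∏ i ∈ s, f i - ∏ i ∈ s, g i‖ := by
        rw [← norm_mul, ← norm_mul]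
        exact norm_add_le _ _
      _ ≤ ‖f a - g a‖ * 1 + 1 * ‖∏ i ∈ s, f i - ∏ i ∈ s, g i‖ := by gcongr
      _ ≤ _ := by linarith

theorem norm_exp_mul_I_sub_le {x : ℝ} (hx : |x| ≤ 1) :
    ‖Complex.exp (x * Complex.I) - (1 + x * Complex.I - x ^ 2 / 2)‖ ≤ |x| ^ 3 := by
  have hnorm : ‖(x : ℂ) * Complex.I‖ = |x| := by simp
  have h := Complex.exp_bound (x := x * Complex.I) (by rwa [hnorm]) (n := 3) (by norm_num)
  rw [hnorm] at h
  have hsum : ∑ m ∈ Finset.range 3, ((x : ℂ) * Complex.I) ^ m / (m.factorial : ℂ) =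
      1 + x * Complex.I - x ^ 2 / 2 := by
    simp [Finset.sum_range_succ, mul_pow, Nat.factorial]
    ring
  rw [hsum] at h
  refine h.trans (mul_le_of_le_one_right (by positivity) ?_)
  norm_num [Nat.factorial]

/-- The characteristic function of a centred Bernoulli variable. -/
noncomputable def centredBernoulliCharFun (p v : ℝ) : ℂ :=
  p * Complex.exp ((v * (1 - p) : ℝ) * Complex.I) +
    (1 - p : ℝ) * Complex.exp ((-(v * p) : ℝ) * Complex.I)

theorem norm_centredBernoulliCharFun_le_one {p v : ℝ} (h₀ : 0 ≤ p) (h₁ : p ≤ 1) :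
    ‖centredBernoulliCharFun p v‖ ≤ 1 := by
  refine (norm_add_le _ _).trans ?_
  rw [norm_mul, norm_mul, Complex.norm_exp_ofReal_mul_I, Complex.norm_exp_ofReal_mul_I,
    Complex.norm_real, Complex.norm_real, Real.norm_of_nonneg h₀,
    Real.norm_of_nonneg (sub_nonneg.mpr h₁)]
  linarith

theorem norm_centredBernoulliCharFun_sub_exp_le {p v : ℝ} (h₀ : 0 ≤ p) (h₁ : p ≤ 1)
    (hv : |v| ≤ 1) :
    ‖centredBernoulliCharFun p v - (Real.exp (-(v ^ 2 * (p * (1 - p)) / 2)) : ℝ)‖ ≤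
      2 * |v| ^ 3 := by
  have hq₀ : 0 ≤ 1 - p := sub_nonneg.mpr h₁
  have hv₀ := abs_nonneg v
  have hvq : |v * (1 - p)| ≤ |v| := by
    rw [abs_mul, abs_of_nonneg hq₀]
    exact mul_le_of_le_one_right hv₀ (by linarith)
  have hvp : |-(v * p)| ≤ |v| := by
    rw [abs_neg, abs_mul, abs_of_nonneg h₀]
    exact mul_le_of_le_one_right hv₀ h₁
  have hq := norm_exp_mul_I_sub_le (hvq.trans hv)
  have hp := norm_exp_mul_I_sub_le (hvp.trans hv)
  have hpq : p * (1 - p) ≤ 1 := by nlinarith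
  have hpq₀ : 0 ≤ p * (1 - p) := mul_nonneg h₀ hq₀
  have hy : |-(v ^ 2 * (p * (1 - p)) / 2)| ≤ v ^ 2 / 2 := by
    rw [abs_neg, abs_of_nonneg (by positivity)]
    gcongr
    exact mul_le_of_le_one_right (sq_nonneg v) hpq
  have hv2 : v ^ 2 ≤ 1 := by rw [← sq_abs]; exact pow_le_one₀ hv₀ hv
  have he := Real.norm_exp_sub_one_sub_id_le (x := -(v ^ 2 * (p * (1 - p)) / 2))
    (by rw [Real.norm_eq_abs]; linarith)
  have he' : ‖Real.exp (-(v ^ 2 * (p * (1 - p)) / 2)) - 1 - -(v ^ 2 * (p * (1 - p)) / 2)‖ ≤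
      |v| ^ 3 := by
    refine he.trans ?_
    rw [Real.norm_eq_abs]
    calc |-(v ^ 2 * (p * (1 - p)) / 2)| ^ 2 ≤ (v ^ 2 / 2) ^ 2 := by gcongr
      _ = |v| ^ 3 * (|v| / 4) := by rw [← sq_abs v]; ring
      _ ≤ |v| ^ 3 := mul_le_of_le_one_right (by positivity) (by linarith)
  rw [← Complex.norm_real] at he'
  set x := v * (1 - p) with hx
  set y := -(v * p) with hy'
  set w := Real.exp (-(v ^ 2 * (p * (1 - p)) / 2)) with hw
  -- Centring cancels the linear terms, and the quadratic terms agree with the Gaussian's because `p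
  -- (1 - p)² + (1 - p) p² = p (1 - p)`. Only remainders are left.
  have hdecomp : centredBernoulliCharFun p v - (w : ℝ) =
      p * (Complex.exp (x * Complex.I) - (1 + x * Complex.I - x ^ 2 / 2)) +
      (1 - p : ℝ) * (Complex.exp (y * Complex.I) - (1 + y * Complex.I - y ^ 2 / 2)) -
      ((w - 1 - -(v ^ 2 * (p * (1 - p)) / 2) : ℝ) : ℂ) := by
    rw [centredBernoulliCharFun, ← hx, ← hy']
    rw [hx, hy']
    push_cast
    ring
  rw [hdecomp]
  refine (norm_sub_le _ _).trans ?_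
  have hadd : ‖(p : ℂ) * (Complex.exp (x * Complex.I) - (1 + x * Complex.I - x ^ 2 / 2)) +
      (1 - p : ℝ) * (Complex.exp (y * Complex.I) - (1 + y * Complex.I - y ^ 2 / 2))‖ ≤
      |v| ^ 3 := by
    refine (norm_add_le _ _).trans ?_
    rw [norm_mul, norm_mul, Complex.norm_real, Complex.norm_real, Real.norm_of_nonneg h₀,
      Real.norm_of_nonneg hq₀]
    calc _ ≤ p * |v| ^ 3 + (1 - p) * |v| ^ 3 := by
          gcongr
          · exact hq.trans (by gcongr)
          · exact hp.trans (by gcongr)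
      _ = |v| ^ 3 := by ring
  linarith

/-- Lyapunov's central limit theorem for a triangular array of Bernoulli variables whose variances
grow at least linearly, in terms of characteristic functions. -/
theorem tendsto_prod_centredBernoulliCharFun (p : ℕ → ℕ → ℝ) (σ : ℕ → ℝ) {c : ℝ} (hc : 0 < c)
    (h₀ : ∀ n k, 0 ≤ p n k) (h₁ : ∀ n k, p n k ≤ 1)
    (hσ : ∀ n, 0 ≤ σ n)
    (hσ_sq : ∀ n, σ n ^ 2 = ∑ k ∈ Finset.range n, p n k * (1 - p n k))
    (hlin : ∀ᶠ n : ℕ in atTop, c * n ≤ σ n ^ 2) (t : ℝ) :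
    Tendsto (fun n ↦ ∏ k ∈ Finset.range n, centredBernoulliCharFun (p n k) (t / σ n)) atTop
      (𝓝 (Complex.exp (-(t ^ 2 / 2)))) := by
  have hσ_top : Tendsto σ atTop atTop := by
    have h : Tendsto (fun n ↦ σ n ^ 2) atTop atTop :=
      tendsto_atTop_mono' _ hlin (tendsto_natCast_atTop_atTop.const_mul_atTop hc)
    refine (Real.tendsto_sqrt_atTop.comp h).congr fun n ↦ ?_
    simp [Real.sqrt_sq (hσ n)]
  have hbound : Tendsto (fun n ↦ (2 * |t| ^ 3 / c) * (σ n)⁻¹) atTop (𝓝 0) := by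
    simpa using hσ_top.inv_tendsto_atTop.const_mul (2 * |t| ^ 3 / c)
  rw [tendsto_iff_norm_sub_tendsto_zero]
  refine squeeze_zero' (.of_forall fun _ ↦ norm_nonneg _) ?_ hbound
  filter_upwards [hlin, hσ_top.eventually_gt_atTop 0, hσ_top.eventually_ge_atTop |t|]
    with n hn hpos hle
  have hv : |t / σ n| ≤ 1 := by
    rw [abs_div, abs_of_pos hpos]
    exact div_le_one_of_le₀ hle hpos.le
  -- The Gaussian limit factors along the individual variances, which allows a factorwise
  -- comparison.
  have hexp : Complex.exp (-(t ^ 2 / 2)) = ∏ k ∈ Finset.range n,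
      ((Real.exp (-((t / σ n) ^ 2 * (p n k * (1 - p n k)) / 2)) : ℝ) : ℂ) := by
    rw [← Complex.ofReal_prod, ← Real.exp_sum, Finset.sum_neg_distrib, ← Finset.sum_div,
      ← Finset.mul_sum, ← hσ_sq, div_pow, div_mul_cancel₀ _ (by positivity)]
    push_cast
    rfl
  rw [hexp]
  refine (norm_prod_sub_prod_le_sum _ _ _
    (fun k _ ↦ norm_centredBernoulliCharFun_le_one (h₀ n k) (h₁ n k)) fun k _ ↦ ?_).trans ?_
  · rw [Complex.norm_real, Real.norm_of_nonneg (Real.exp_pos _).le, Real.exp_le_one_iff]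
    have := mul_nonneg (h₀ n k) (sub_nonneg.mpr (h₁ n k))
    have : 0 ≤ (t / σ n) ^ 2 * (p n k * (1 - p n k)) / 2 := by positivity
    linarith
  refine (Finset.sum_le_sum fun k _ ↦
    norm_centredBernoulliCharFun_sub_exp_le (h₀ n k) (h₁ n k) hv).trans ?_
  rw [Finset.sum_const, Finset.card_range, nsmul_eq_mul, abs_div, abs_of_pos hpos]
  -- Linear variance growth turns `n` errors of order `σ⁻³` into a total of order `σ⁻¹`.
  have hn' : (n : ℝ) ≤ σ n ^ 2 / c := by rw [le_div_iff₀ hc]; linarith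
  calc (n : ℝ) * (2 * (|t| / σ n) ^ 3) ≤ σ n ^ 2 / c * (2 * (|t| / σ n) ^ 3) := by gcongr
    _ = 2 * |t| ^ 3 / c * (σ n)⁻¹ := by field_simp

/-! ### Uniform convergence of distribution functions -/

/-- **Pólya's theorem**: monotone functions with values in `[0, 1]` that converge pointwise to a
continuous distribution function converge uniformly. -/
theorem eventually_forall_abs_sub_le_of_monotone {F : ℕ → ℝ → ℝ} {G : ℝ → ℝ}
    (hF : ∀ n, Monotone (F n)) (hF₀ : ∀ n x, 0 ≤ F n x) (hF₁ : ∀ n x, F n x ≤ 1)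
    (hG : Monotone G) (hGc : Continuous G)
    (hbot : Tendsto G atBot (𝓝 0)) (htop : Tendsto G atTop (𝓝 1))
    (hlim : ∀ x, Tendsto (fun n ↦ F n x) atTop (𝓝 (G x))) {ε : ℝ} (hε : 0 < ε) :
    ∀ᶠ n in atTop, ∀ x, |F n x - G x| ≤ ε := by
  have hG₀ : ∀ x, 0 ≤ G x := hG.le_of_tendsto hbot
  have hG₁ : ∀ x, G x ≤ 1 := hG.ge_of_tendsto htop
  have hsurj : ∀ y ∈ Set.Ioo (0 : ℝ) 1, ∃ x, G x = y := fun y hy ↦ by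
    obtain ⟨a, ha⟩ := (hbot.eventually_lt_const hy.1).exists
    obtain ⟨b, hb⟩ := (htop.eventually_const_lt hy.2).exists
    exact mem_range_of_exists_le_of_exists_ge hGc ⟨a, ha.le⟩ ⟨b, hb.le⟩
  -- Of the three meshes `1 / m`, one pays for the error at a grid point and at most two for the
  -- variation of `G` between it and `x`.
  obtain ⟨m, hm⟩ := exists_nat_gt (3 / ε)
  have hm₀ : (0 : ℝ) < m := (by positivity : (0 : ℝ) < 3 / ε).trans hm
  have hmε : 3 / (m : ℝ) < ε := by rwa [div_lt_comm₀ hm₀ hε]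
  -- The levels 0 and 1 are left out, as `G` need not attain them; 0 is a dummy point.
  have hgrid : ∀ j : ℕ, ∃ x, 0 < j → j < m → G x = j / m := fun j ↦ by
    by_cases h : 0 < j ∧ j < m
    · obtain ⟨x, hx⟩ := hsurj ((j : ℝ) / m)
        ⟨div_pos (by exact_mod_cast h.1) hm₀, (div_lt_one hm₀).mpr (by exact_mod_cast h.2)⟩
      exact ⟨x, fun _ _ ↦ hx⟩
    · exact ⟨0, fun h₁ h₂ ↦ (h ⟨h₁, h₂⟩).elim⟩
  choose g hg using hgrid
  have hev : ∀ᶠ n in atTop, ∀ j ∈ Finset.range m, |F n (g j) - G (g j)| < 1 / m := by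
    rw [Filter.eventually_all_finset]
    intro j _
    have := Metric.tendsto_nhds.mp (hlim (g j)) (1 / m) (by positivity)
    simpa [Real.dist_eq] using this
  filter_upwards [hev] with n hn x
  have hthree : (3 : ℝ) / m = 1 / m + 1 / m + 1 / m := by ring
  have hone : (0 : ℝ) < 1 / m := by positivity
  set j := ⌊m * G x⌋₊ with hj
  have hjle : (j : ℝ) / m ≤ G x := by
    rw [div_le_iff₀ hm₀, mul_comm]
    exact Nat.floor_le (mul_nonneg hm₀.le (hG₀ x))
  have hjlt : G x < (j : ℝ) / m + 1 / m := by
    rw [← add_div, lt_div_iff₀ hm₀, mul_comm]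
    exact Nat.lt_floor_add_one _
  have hjm : j ≤ m := by
    have : (j : ℝ) / m ≤ 1 := hjle.trans (hG₁ x)
    rw [div_le_one hm₀] at this
    exact_mod_cast this
  rw [abs_le]
  constructor
  -- Level `j - 1` lies strictly below `G x`, which forces its grid point to the left of `x` even
  -- where `G` is flat.
  · rcases Nat.lt_or_ge 1 j with h | h
    · have hgj := hg (j - 1) (by omega) (by omega)
      have hcast : ((j - 1 : ℕ) : ℝ) / m = j / m - 1 / m := by
        rw [Nat.cast_sub h.le]; push_cast; ring
      have hle : g (j - 1) ≤ x := by
        by_contra hcon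
        have := hG (not_le.mp hcon).le
        linarith
      have h₁ := hF n hle
      have h₂ := (abs_lt.mp (hn (j - 1) (Finset.mem_range.mpr (by omega)))).1
      linarith
    · have : (j : ℝ) / m ≤ 1 / m := by
        gcongr
        exact_mod_cast h
      linarith [hF₀ n x]
  · rcases Nat.lt_or_ge (j + 1) m with h | h
    · have hgj := hg (j + 1) (by omega) h
      have hcast : ((j + 1 : ℕ) : ℝ) / m = j / m + 1 / m := by push_cast; ring
      have hle : x ≤ g (j + 1) := by
        by_contra hcon
        have := hG (not_le.mp hcon).le
        linarith
      have h₁ := hF n hle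
      have h₂ := (abs_lt.mp (hn (j + 1) (Finset.mem_range.mpr h))).2
      linarith
    · have : (1 : ℝ) ≤ j / m + 1 / m := by
        rw [← add_div, le_div_iff₀ hm₀, one_mul]
        exact_mod_cast h
      linarith [hF₁ n x]

/-- The jump at a point is the mass of that point. -/
theorem continuous_cdf (μ : Measure ℝ) [IsProbabilityMeasure μ] [NullSingletonClass μ] :
    Continuous (cdf μ) := by
  refine continuous_iff_continuousAt.mpr fun x ↦ ?_
  rw [(monotone_cdf μ).continuousAt_iff_leftLim_eq_rightLim, StieltjesFunction.rightLim_eq]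
  have h := StieltjesFunction.measure_singleton (cdf μ) x
  rw [measure_cdf, measure_singleton] at h
  have h' := ENNReal.ofReal_eq_zero.mp h.symm
  exact le_antisymm ((monotone_cdf μ).leftLim_le le_rfl) (by linarith)

theorem stdNormalCDF_eq_cdf (x : ℝ) : stdNormalCDF x = cdf (gaussianReal 0 1) x := by
  rw [cdf_eq_real, measureReal_def, gaussianReal_apply_eq_integral 0 one_ne_zero,
    ENNReal.toReal_ofReal (integral_nonneg fun _ ↦ gaussianPDFReal_nonneg _ _ _)]
  simp only [gaussianPDFReal_def, stdNormalCDF, integral_const_mul]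
  simp

/-- Convergence in distribution to a law without atoms makes the distribution functions converge
uniformly. -/
theorem eventually_forall_abs_cdf_sub_le {μ : ℕ → ProbabilityMeasure ℝ}
    {ν : ProbabilityMeasure ℝ} (h : Tendsto μ atTop (𝓝 ν))
    (hν : NullSingletonClass (ν : Measure ℝ))
    {ε : ℝ} (hε : 0 < ε) :
    ∀ᶠ n in atTop, ∀ x, |cdf (μ n : Measure ℝ) x - cdf (ν : Measure ℝ) x| ≤ ε := by
  refine eventually_forall_abs_sub_le_of_monotone (fun n ↦ monotone_cdf _)
    (fun n ↦ cdf_nonneg _) (fun n ↦ cdf_le_one _) (monotone_cdf _) (continuous_cdf _)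
    (tendsto_cdf_atBot _) (tendsto_cdf_atTop _) (fun x ↦ ?_) hε
  simp only [cdf_eq_real]
  have := ProbabilityMeasure.tendsto_measure_of_null_frontier_of_tendsto' h (E := Set.Iic x)
    (by rw [frontier_Iic]; exact measure_singleton x)
  exact (ENNReal.tendsto_toReal (measure_ne_top _ _)).comp this

theorem tendsto_supNorm_zero {f : ℕ → ℝ → ℝ}
    (h : ∀ ε > 0, ∀ᶠ n in atTop, ∀ x, |f n x| ≤ ε) :
    Tendsto (fun n ↦ supNorm (f n)) atTop (𝓝 0) := by
  rw [ENNReal.tendsto_nhds_zero]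
  intro ε hε
  rcases eq_or_ne ε ∞ with rfl | hε'
  · simp
  filter_upwards [h ε.toReal (ENNReal.toReal_pos hε.ne' hε')] with n hn
  refine iSup_le fun x ↦ ?_
  rw [Real.enorm_eq_ofReal_abs]
  exact ENNReal.ofReal_le_of_le_toReal (hn x)

/-! ### Laws carried by finitely many integers -/

section FinitelySupported

variable {μ : Measure ℝ} [IsProbabilityMeasure μ] {c : ℕ → ℝ} {N : ℕ}

/-- The prescribed masses already add up to 1, so `μ` lives on these points and any `f` is
integrable. -/
theorem integral_eq_sum_range (hc : ∀ k ∈ Finset.range N, μ.real {(k : ℝ)} = c k)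
    (hsum : ∑ k ∈ Finset.range N, c k = 1) {E : Type*} [NormedAddCommGroup E] [NormedSpace ℝ E]
    [CompleteSpace E] (f : ℝ → E) : ∫ x, f x ∂μ = ∑ k ∈ Finset.range N, c k • f k := by
  set T : Finset ℝ := (Finset.range N).map Nat.castEmbedding with hT
  have hmeas : μ.real (T : Set ℝ) = 1 := by
    rw [← sum_measureReal_singleton, hT, Finset.sum_map, ← hsum]
    exact Finset.sum_congr rfl hc
  have hae : ∀ᵐ x ∂μ, x ∈ (T : Set ℝ) := by
    rw [measureReal_def, ENNReal.toReal_eq_one_iff] at hmeas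
    exact (mem_ae_iff_prob_eq_one T.measurableSet).mpr hmeas
  rw [← Measure.restrict_eq_self_of_ae_mem hae, setIntegral_finset, hT, Finset.sum_map]
  · exact Finset.sum_congr rfl fun k hk ↦ by rw [← hc k hk]; rfl
  · exact IntegrableOn.finset

theorem measureReal_eq_sum_range (hc : ∀ k ∈ Finset.range N, μ.real {(k : ℝ)} = c k)
    (hsum : ∑ k ∈ Finset.range N, c k = 1) {s : Set ℝ} [DecidablePred fun k : ℕ ↦ (k : ℝ) ∈ s]
    (hs : MeasurableSet s) : μ.real s = ∑ k ∈ Finset.range N with ((k : ℕ) : ℝ) ∈ s, c k := by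
  rw [← integral_indicator_one hs, integral_eq_sum_range hc hsum, Finset.sum_filter]
  refine Finset.sum_congr rfl fun k _ ↦ ?_
  by_cases h : (k : ℝ) ∈ s <;> simp [h]

end FinitelySupported

section BernoulliSum

variable {μ : Measure ℝ} [IsProbabilityMeasure μ] {p : ℕ → ℝ} {n : ℕ}

theorem integral_id_of_bernoulliSumPoly
    (hμ : ∀ k ∈ Finset.range (n + 1), μ.real {(k : ℝ)} = (bernoulliSumPoly p n).coeff k) :
    ∫ x, x ∂μ = ∑ k ∈ Finset.range n, p k := by
  rw [integral_eq_sum_range hμ (sum_coeff_bernoulliSumPoly p n)]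
  exact sum_coeff_bernoulliSumPoly_mul_natCast p n

theorem variance_id_of_bernoulliSumPoly
    (hμ : ∀ k ∈ Finset.range (n + 1), μ.real {(k : ℝ)} = (bernoulliSumPoly p n).coeff k) :
    variance id μ = ∑ k ∈ Finset.range n, p k * (1 - p k) := by
  rw [variance_eq_integral measurable_id.aemeasurable]
  simp only [id_eq]
  rw [integral_id_of_bernoulliSumPoly hμ,
    integral_eq_sum_range hμ (sum_coeff_bernoulliSumPoly p n)]
  exact sum_coeff_bernoulliSumPoly_mul_sub_sq p n

/-- The generating polynomial is evaluated at `exp (iv)`, and the centring phase is distributed over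
its factors. -/
theorem integral_exp_of_bernoulliSumPoly
    (hμ : ∀ k ∈ Finset.range (n + 1), μ.real {(k : ℝ)} = (bernoulliSumPoly p n).coeff k) (v : ℝ) :
    ∫ x, Complex.exp ((v * (x - ∑ k ∈ Finset.range n, p k) : ℝ) * Complex.I) ∂μ =
      ∏ k ∈ Finset.range n, centredBernoulliCharFun (p k) v := by
  rw [integral_eq_sum_range hμ (sum_coeff_bernoulliSumPoly p n)]
  have hdeg : ((bernoulliSumPoly p n).map (algebraMap ℝ ℂ)).natDegree < n + 1 :=
    Nat.lt_succ_iff.mpr (Polynomial.natDegree_map_le.trans (natDegree_bernoulliSumPoly_le p n))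
  have heval := Polynomial.eval_eq_sum_range' hdeg (Complex.exp (v * Complex.I))
  have hprod : ((bernoulliSumPoly p n).map (algebraMap ℝ ℂ)).eval (Complex.exp (v * Complex.I)) =
      ∏ k ∈ Finset.range n, (p k * Complex.exp (v * Complex.I) + (1 - p k : ℝ)) := by
    rw [bernoulliSumPoly, Polynomial.map_prod, Polynomial.eval_prod]
    simp
  calc ∑ k ∈ Finset.range (n + 1), (bernoulliSumPoly p n).coeff k •
        Complex.exp ((v * ((k : ℝ) - ∑ j ∈ Finset.range n, p j) : ℝ) * Complex.I)
      = Complex.exp (∑ j ∈ Finset.range n, (-(v * p j) : ℝ) * Complex.I) *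
          ∑ k ∈ Finset.range (n + 1), ((bernoulliSumPoly p n).map (algebraMap ℝ ℂ)).coeff k *
            Complex.exp (v * Complex.I) ^ k := by
        rw [Finset.mul_sum]
        refine Finset.sum_congr rfl fun k _ ↦ ?_
        rw [Polynomial.coeff_map, ← Complex.exp_nat_mul, mul_left_comm, ← Complex.exp_add,
          Complex.real_smul, ← Finset.sum_mul, ← Complex.ofReal_sum, Finset.sum_neg_distrib,
          ← Finset.mul_sum]
        congr 2
        push_cast
        ring
    _ = _ := by
        rw [← heval, hprod, Complex.exp_sum, ← Finset.prod_mul_distrib]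
        refine Finset.prod_congr rfl fun k _ ↦ ?_
        rw [centredBernoulliCharFun, mul_add, mul_left_comm, ← Complex.exp_add,
          mul_comm (Complex.exp _) ((1 - p k : ℝ) : ℂ)]
        congr 3
        push_cast
        ring

end BernoulliSum

/-! ### The limit theorem -/

theorem theorem2 {Ω : ℕ → Type*} [∀ n, MeasurableSpace (Ω n)]
    (P : ∀ n, Measure (Ω n)) [∀ n, IsProbabilityMeasure (P n)]
    (X : ∀ n, Ω n → ℝ) (hX : ∀ n, AEMeasurable (X n) (P n))
    (hlaw : ∀ n, ∀ k ∈ Finset.range (n + 1),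
      (P n).real {ω | X n ω = (k : ℝ)} = (A n k : ℝ) / ∑ m ∈ Finset.range (n + 1), (A n m : ℝ)) :
    (∀ n, 2 ≤ n → 0 < variance (X n) (P n)) ∧
    TendstoInDistribution (fun n => standardized (P n) (X n)) atTop
      (id : ℝ → ℝ) P (gaussianReal 0 1) ∧
    Tendsto (fun n => supNorm fun x =>
        (P n).real {ω | standardized (P n) (X n) ω ≤ x} - stdNormalCDF x) atTop (𝓝 0) ∧
    Tendsto (fun n => supNorm fun x =>
        1 / (∑ m ∈ Finset.range (n + 1), (A n m : ℝ)) *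
          (∑ k ∈ Finset.range (n + 1) with
            ((k : ℕ) : ℝ) ≤ (∫ ω, X n ω ∂(P n)) + Real.sqrt (variance (X n) (P n)) * x,
            (A n k : ℝ)) - stdNormalCDF x) atTop (𝓝 0) := by
  have hprob : ∀ n, IsProbabilityMeasure ((P n).map (X n)) := fun n ↦
    Measure.isProbabilityMeasure_map (hX n)
  have hcoeff : ∀ n, ∀ k ∈ Finset.range (n + 1), ((P n).map (X n)).real {(k : ℝ)} =
      (bernoulliSumPoly (bernoulliProb n) n).coeff k := fun n k hk ↦ by
    rw [map_measureReal_apply_of_aemeasurable (hX n) (measurableSet_singleton _),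
      coeff_bernoulliSumPoly_bernoulliProb, ← hlaw n k hk]
    rfl
  have hmean : ∀ n, ∫ ω, X n ω ∂(P n) = ∑ k ∈ Finset.range n, bernoulliProb n k := fun n ↦ by
    rw [← integral_id_of_bernoulliSumPoly (hcoeff n), integral_map (hX n) (by fun_prop)]
  have hvar : ∀ n, variance (X n) (P n) =
      ∑ k ∈ Finset.range n, bernoulliProb n k * (1 - bernoulliProb n k) := fun n ↦ by
    rw [← variance_id_of_bernoulliSumPoly (hcoeff n), variance_id_map (hX n)]
  have hvar_ge : ∀ n : ℕ, 2 ≤ n → (n : ℝ) / 25 ≤ variance (X n) (P n) := fun n hn ↦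
    (sum_bernoulliProb_mul_one_sub_ge hn).trans_eq (hvar n).symm
  have hvar_pos : ∀ n, 2 ≤ n → 0 < variance (X n) (P n) := fun n hn ↦
    lt_of_lt_of_le (by positivity) (hvar_ge n hn)
  have hmeas : ∀ n, AEMeasurable (standardized (P n) (X n)) (P n) := fun n ↦
    ((hX n).sub_const _).div_const _
  have hdistr : TendstoInDistribution (fun n ↦ standardized (P n) (X n)) atTop
      (id : ℝ → ℝ) P (gaussianReal 0 1) := by
    refine ⟨hmeas, aemeasurable_id, ?_⟩
    -- Lévy's continuity theorem.
    refine ProbabilityMeasure.tendsto_of_tendsto_charFun fun t ↦ ?_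
    have hlim := tendsto_prod_centredBernoulliCharFun bernoulliProb
      (fun n ↦ √(variance (X n) (P n))) (c := 1 / 25) (by norm_num)
      (fun n k ↦ (bernoulliProb_pos n k).le) bernoulliProb_le_one (fun n ↦ Real.sqrt_nonneg _)
      (fun n ↦ (Real.sq_sqrt (variance_nonneg _ _)).trans (hvar n))
      ((eventually_ge_atTop 2).mono fun n hn ↦ by
        rw [Real.sq_sqrt (variance_nonneg _ _)]
        linarith [hvar_ge n hn]) t
    have hgauss : charFun (Measure.map id (gaussianReal 0 1)) t =
        Complex.exp (-(t ^ 2 / 2)) := by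
      rw [Measure.map_id, charFun_gaussianReal]
      simp
    simp only [ProbabilityMeasure.coe_mk]
    rw [hgauss]
    refine hlim.congr fun n ↦ ?_
    rw [← integral_exp_of_bernoulliSumPoly (hcoeff n), integral_map (hX n) (by fun_prop),
      charFun_apply_real, integral_map (hmeas n) (by fun_prop)]
    refine integral_congr_ae (.of_forall fun ω ↦ ?_)
    simp only [standardized, hmean]
    congr 2
    push_cast
    ring
  have hunif : ∀ ε > 0, ∀ᶠ n in atTop, ∀ x,
      |(P n).real {ω | standardized (P n) (X n) ω ≤ x} - stdNormalCDF x| ≤ ε := fun ε hε ↦ by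
    have : NullSingletonClass (gaussianReal 0 1) := nullSingletonClass_gaussianReal one_ne_zero
    have hmap : Measure.map id (gaussianReal 0 1) = gaussianReal 0 1 := Measure.map_id
    have hnull : NullSingletonClass (Measure.map id (gaussianReal 0 1)) := by rwa [hmap]
    filter_upwards [eventually_forall_abs_cdf_sub_le hdistr.tendsto hnull hε] with n hn x
    have := Measure.isProbabilityMeasure_map (hmeas n)
    have h := hn x
    simp only [ProbabilityMeasure.coe_mk] at h
    rwa [hmap, ← stdNormalCDF_eq_cdf, cdf_eq_real,
      map_measureReal_apply_of_aemeasurable (hmeas n) measurableSet_Iic] at h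
  refine ⟨hvar_pos, hdistr, tendsto_supNorm_zero hunif, tendsto_supNorm_zero fun ε hε ↦ ?_⟩
  filter_upwards [hunif ε hε, eventually_ge_atTop 2] with n hn hn₂ x
  convert hn x using 3
  -- Positivity lets the standard deviation be cleared, so both forms describe the same event.
  have hσ : 0 < √(variance (X n) (P n)) := Real.sqrt_pos.mpr (hvar_pos n hn₂)
  have hset : {ω | standardized (P n) (X n) ω ≤ x} =
      X n ⁻¹' Set.Iic ((∫ ω, X n ω ∂(P n)) + √(variance (X n) (P n)) * x) := by
    ext ω
    simp only [standardized, Set.mem_ofPred_eq, Set.mem_preimage, Set.mem_Iic]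
    rw [div_le_iff₀ hσ, sub_le_iff_le_add', mul_comm]
  rw [hset, ← map_measureReal_apply_of_aemeasurable (hX n) measurableSet_Iic,
    measureReal_eq_sum_range (hcoeff n) (sum_coeff_bernoulliSumPoly _ n) measurableSet_Iic,
    Finset.mul_sum]
  simp only [coeff_bernoulliSumPoly_bernoulliProb, Set.mem_Iic]
  exact Finset.sum_congr rfl fun k _ ↦ one_div_mul_eq_div _ _
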